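/- Let $k$ be a field, let $R$ be an associative unital $k$-algebra (not necessarily commutative) which is a semiprime ring (that is, $aRa=0$ with $a\in R$ implies $a=0$), and let $G$ be a torsion group. Let $\alpha\colon G\times G\to k^{*}$ be a $2$-cocycle, i.e. $\alpha(x,y)\,\alpha(xy,z)=\alpha(y,z)\,\alpha(x,yz)$ for all $x,y,z\in G$. The $\alpha$-center of $G$ is the subgroup $$Z_\alpha(G)=\{a\in Z(G) : \alpha(a,x)=\alpha(x,a)\ \text{for all } x\in G\},$$ where $Z(G)$ is the center of $G$. The twisted group ring $R^\alpha G$ is the free left $R$-module with basis $\{\overline g : g\in G\}$ and with the biadditive multiplication determined by $(a\overline g)(b\overline h)=ab\,\alpha(g,h)\,\overline{gh}$ for $a,b\in R$, $g,h\in G$; it is an associative ring with identity $\alpha(1,1)^{-1}\,\overline{1}$ (which is $\overline 1$ if $\alpha$ is normalized), and $R$ is regarded as a subring of it through $r\mapsto r\cdot 1_{R^\alpha G}$. An $R$-derivation of $R^\alpha G$ is a map $d\colon R^\alpha G\to R^\alpha G$ with $d(x+y)=d(x)+d(y)$ and $d(xy)=d(x)y+x\,d(y)$ for all $x,y\in R^\alpha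 G$, and with $d(r)=0$ for all $r\in R$. Suppose that $[G:Z_\alpha(G)]<\infty$ and that either $\operatorname{char} R=0$ or, if $R$ has prime characteristic $p$, $p$ does not divide the order of any element of $G$. Then every $R$-derivation $d$ of $R^\alpha G$ is inner: there is an element $a\in R^\alpha G$ such that $d(x)=ax-xa$ for all $x\in R^\alpha G$. -/

import Mathlib

/-- A (multiplicative) `2`-cocycle `G × G → A`, where `G` acts trivially on the abelian group `A`.
It is not required to be normalized. -/
structure TwoCocycle (G A : Type*) [Group G] [CommGroup A] where
  toFun : G → G → A
  cocycle' : ∀ x y z : G, toFun x y * toFun (x * y) z = toFun y z * toFun x (y * z)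

namespace TwoCocycle

variable {G A : Type*} [Group G] [CommGroup A]

instance : CoeFun (TwoCocycle G A) (fun _ => G → G → A) := ⟨TwoCocycle.toFun⟩

theorem cocycle (α : TwoCocycle G A) (x y z : G) :
    α x y * α (x * y) z = α y z * α x (y * z) := α.cocycle' x y z

theorem one_left (α : TwoCocycle G A) (g : G) : α 1 g = α 1 1 := by
  have h := α.cocycle 1 1 g
  simp only [one_mul] at h
  exact (mul_right_cancel h).symm

theorem one_right (α : TwoCocycle G A) (g : G) : α g 1 = α 1 1 := by
  have h := α.cocycle g 1 1
  simp only [mul_one] at h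
  exact mul_right_cancel h

/-- The `α`-center of `G`: the central elements `a` with `α(a, x) = α(x, a)` for all `x`. -/
def center (α : TwoCocycle G A) : Subgroup G where
  carrier := {a | a ∈ Subgroup.center G ∧ ∀ x, α a x = α x a}
  one_mem' := ⟨one_mem _, fun x => by rw [α.one_left, α.one_right x]⟩
  mul_mem' := by
    rintro a b ⟨ha, ha'⟩ ⟨hb, hb'⟩
    refine ⟨mul_mem ha hb, fun x => ?_⟩
    rw [Subgroup.mem_center_iff] at ha hb
    have h1 := α.cocycle a b x
    have h2 := α.cocycle x a b
    have h3 := α.cocycle a x b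
    rw [← hb x, hb' x] at h1
    rw [ha x, ← ha' x] at h2
    exact mul_left_cancel ((h1.trans h3.symm).trans h2)
  inv_mem' := by
    rintro a ⟨ha, ha'⟩
    refine ⟨inv_mem ha, fun x => ?_⟩
    have hai := inv_mem ha
    rw [Subgroup.mem_center_iff] at ha hai
    have h1 := α.cocycle a a⁻¹ x
    have h2 := α.cocycle x a⁻¹ a
    rw [mul_inv_cancel, α.one_left] at h1
    rw [inv_mul_cancel, α.one_right x, hai x, ← ha' (a⁻¹ * x), ← ha' a⁻¹] at h2
    exact (mul_right_cancel (h2.trans h1)).symm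

theorem mem_center {α : TwoCocycle G A} {a : G} :
    a ∈ α.center ↔ a ∈ Subgroup.center G ∧ ∀ x, α a x = α x a := Iff.rfl

end TwoCocycle

/-- The twisted group ring `R^α G` of a `k`-algebra `R` and a cocycle `α : G × G → kˣ`:
the free left `R`-module with basis the symbols `\bar g`, for `g` in `G`. -/
def TwistedGroupRing {k G : Type*} (R : Type*) [CommRing k] [Ring R] [Algebra k R] [Group G]
    (_α : TwoCocycle G kˣ) : Type _ := G →₀ R

namespace TwistedGroupRing

variable {k R G : Type*} [CommRing k] [Ring R] [Algebra k R] [Group G] {α : TwoCocycle G kˣ}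

noncomputable instance : AddCommGroup (TwistedGroupRing R α) :=
  inferInstanceAs (AddCommGroup (G →₀ R))

noncomputable instance : Module R (TwistedGroupRing R α) :=
  inferInstanceAs (Module R (G →₀ R))

/-- The element `r \bar g`. -/
noncomputable def single (g : G) (r : R) : TwistedGroupRing R α := Finsupp.single g r

theorem single_zero (g : G) : (single g 0 : TwistedGroupRing R α) = 0 :=
  Finsupp.single_zero g

theorem single_add (g : G) (r s : R) :
    (single g (r + s) : TwistedGroupRing R α) = single g r + single g s :=
  Finsupp.single_add g r s

theorem smul_single (g : G) (r s : R) :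
    r • (single g s : TwistedGroupRing R α) = single g (r * s) :=
  Finsupp.smul_single r g s

theorem induction_on {p : TwistedGroupRing R α → Prop} (x : TwistedGroupRing R α)
    (zero : p 0) (add : ∀ x y, p x → p y → p (x + y)) (single : ∀ g r, p (single g r)) : p x :=
  Finsupp.induction_linear x zero add single

/-- The biadditive product with `(a \bar g) (b \bar h) = a b α(g, h) \overline{gh}`. -/
noncomputable instance : Mul (TwistedGroupRing R α) where
  mul x y := Finsupp.sum x fun g a => Finsupp.sum y fun h b =>
    single (g * h) ((α g h : k) • (a * b))

theorem mul_def (x y : TwistedGroupRing R α) :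
    x * y = Finsupp.sum x fun g a => Finsupp.sum y fun h b =>
      (single (g * h) ((α g h : k) • (a * b)) : TwistedGroupRing R α) := rfl

protected theorem add_mul' (x y z : TwistedGroupRing R α) : (x + y) * z = x * z + y * z := by
  classical
  simp only [mul_def]
  refine (Finsupp.sum_add_index ?_ ?_)
  · intro g _
    simp [single_zero, Finsupp.sum]
  · intro g _ a b
    simp [add_mul, single_add, Finsupp.sum, Finset.sum_add_distrib]

protected theorem mul_add' (x y z : TwistedGroupRing R α) : x * (y + z) = x * y + x * z := by
  classical
  simp only [mul_def]
  refine (Finset.sum_congr rfl fun g _ => ?_).trans Finset.sum_add_distrib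
  refine (Finsupp.sum_add_index ?_ ?_)
  · intro h _
    simp [single_zero]
  · intro h _ a b
    simp [mul_add, single_add]

protected theorem zero_mul' (x : TwistedGroupRing R α) : 0 * x = 0 := by
  have h := TwistedGroupRing.add_mul' 0 0 x
  simpa using h

protected theorem mul_zero' (x : TwistedGroupRing R α) : x * 0 = 0 := by
  have h := TwistedGroupRing.mul_add' x 0 0
  simpa using h

theorem single_mul_single (g h : G) (a b : R) :
    (single g a * single h b : TwistedGroupRing R α) =
      single (g * h) ((α g h : k) • (a * b)) := by
  rw [mul_def]
  refine (Finsupp.sum_single_index ?_).trans (Finsupp.sum_single_index ?_)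
  · simp [single_zero, Finsupp.sum]
  · simp [single_zero]

/-- The identity element is `α(1, 1)⁻¹ \bar 1`, which is `\bar 1` if `α` is normalized. -/
noncomputable instance : One (TwistedGroupRing R α) where
  one := single 1 (algebraMap k R ((α 1 1)⁻¹ : kˣ))

theorem one_def :
    (1 : TwistedGroupRing R α) = single 1 (algebraMap k R ((α 1 1)⁻¹ : kˣ)) := rfl

protected theorem one_mul' (x : TwistedGroupRing R α) : 1 * x = x := by
  induction x using induction_on with
  | zero => exact TwistedGroupRing.mul_zero' _
  | add x y hx hy => rw [TwistedGroupRing.mul_add', hx, hy]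
  | single g r =>
    rw [one_def, single_mul_single, one_mul, α.one_left, ← Algebra.smul_def, smul_smul,
      Units.mul_inv, one_smul]

protected theorem mul_one' (x : TwistedGroupRing R α) : x * 1 = x := by
  induction x using induction_on with
  | zero => exact TwistedGroupRing.zero_mul' _
  | add x y hx hy => rw [TwistedGroupRing.add_mul', hx, hy]
  | single g r =>
    rw [one_def, single_mul_single, mul_one, α.one_right g, ← Algebra.commutes,
      ← Algebra.smul_def, smul_smul, Units.mul_inv, one_smul]

protected theorem mul_assoc' (x y z : TwistedGroupRing R α) : x * y * z = x * (y * z) := by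
  induction x using induction_on with
  | zero => simp only [TwistedGroupRing.zero_mul']
  | add x x' hx hx' => simp only [TwistedGroupRing.add_mul', hx, hx']
  | single g a =>
    induction y using induction_on with
    | zero => simp only [TwistedGroupRing.zero_mul', TwistedGroupRing.mul_zero']
    | add y y' hy hy' => simp only [TwistedGroupRing.add_mul', TwistedGroupRing.mul_add', hy, hy']
    | single h b =>
      induction z using induction_on with
      | zero => simp only [TwistedGroupRing.mul_zero']
      | add z z' hz hz' => simp only [TwistedGroupRing.mul_add', hz, hz']
      | single l c =>
        have key : (α (g * h) l : k) * (α g h : k) = (α g (h * l) : k) * (α h l : k) := by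
          rw [mul_comm, mul_comm (α g (h * l) : k)]
          exact_mod_cast congrArg Units.val (α.cocycle g h l)
        simp only [single_mul_single, smul_mul_assoc, mul_smul_comm, smul_smul, mul_assoc, key]

noncomputable instance : Ring (TwistedGroupRing R α) :=
  { (inferInstance : AddCommGroup (TwistedGroupRing R α)) with
    mul := (· * ·)
    one := 1
    left_distrib := TwistedGroupRing.mul_add'
    right_distrib := TwistedGroupRing.add_mul'
    zero_mul := TwistedGroupRing.zero_mul'
    mul_zero := TwistedGroupRing.mul_zero'
    mul_assoc := TwistedGroupRing.mul_assoc'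
    one_mul := TwistedGroupRing.one_mul'
    mul_one := TwistedGroupRing.mul_one' }

/-- The canonical embedding `r ↦ r 1` of `R` in `R^α G`, through which `R` is regarded as a
subring of `R^α G`; if `α` is normalized it is `r ↦ r \bar 1`. -/
noncomputable def incl : R →+* TwistedGroupRing R α where
  toFun r := r • (1 : TwistedGroupRing R α)
  map_one' := one_smul _ _
  map_zero' := zero_smul _ _
  map_add' r s := add_smul r s _
  map_mul' r s := by
    simp only [one_def, smul_single, single_mul_single, one_mul]
    congr 1
    rw [← Algebra.commutes _ s, ← Algebra.commutes _ r, ← Algebra.commutes, ← Algebra.smul_def,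
      ← Algebra.smul_def, ← Algebra.smul_def, smul_mul_smul_comm, smul_smul, ← mul_assoc,
      Units.mul_inv, one_mul]

theorem incl_mul_single (r s : R) (g : G) :
    incl r * (single g s : TwistedGroupRing R α) = single g (r * s) := by
  change r • (1 : TwistedGroupRing R α) * single g s = _
  rw [one_def, smul_single, single_mul_single, one_mul, α.one_left, ← Algebra.commutes,
    ← Algebra.smul_def, smul_mul_assoc, smul_smul, Units.mul_inv, one_smul]

theorem single_mul_incl (r s : R) (g : G) :
    (single g s : TwistedGroupRing R α) * incl r = single g (s * r) := by
  change single g s * r • (1 : TwistedGroupRing R α) = _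
  rw [one_def, smul_single, single_mul_single, mul_one, α.one_right g, ← Algebra.commutes,
    ← Algebra.smul_def, mul_smul_comm, smul_smul, Units.mul_inv, one_smul]

end TwistedGroupRing

/-- A ring is semiprime if `a R a = 0` implies `a = 0`. -/
def IsSemiprimeRing (R : Type*) [Ring R] : Prop :=
  ∀ a : R, (∀ r : R, a * r * a = 0) → a = 0

/-- A derivation of a ring: an additive map satisfying the Leibniz rule. -/
structure IsRingDerivation {S : Type*} [Ring S] (d : S → S) : Prop where
  map_add : ∀ a b : S, d (a + b) = d a + d b
  leibniz : ∀ a b : S, d (a * b) = d a * b + a * d b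

/-- `d` is an `R`-derivation of `S`, where `R` is regarded as a subring of `S` through `i`. -/
structure IsRelDerivation {R S : Type*} [Ring R] [Ring S] (i : R →+* S) (d : S → S) : Prop
    extends IsRingDerivation d where
  map_incl : ∀ r : R, d (i r) = 0

/-- The map `d` is the inner derivation induced by some `a`. -/
def IsInnerDerivation {S : Type*} [Ring S] (d : S → S) : Prop :=
  ∃ a : S, ∀ x : S, d x = a * x - x * a

/-! Put `δ(g) = d(ḡ) ḡ⁻¹`. The Leibniz rule makes `δ` a crossed homomorphism for conjugation
(`logDeriv_mul`), with values commuting with `R`. For `z` in the `α`-center, `z̄` is central, so `δ`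
is additive there and `orderOf z` kills `δ(z)`; as that order is invertible in `k`, `δ(z) = 0`.
Hence `δ` is constant on cosets of the `α`-center, and averaging it over the finite quotient, whose
index is invertible by Cauchy's theorem, gives the element inducing `d`. -/

open TwistedGroupRing in
/-- The unit `\bar g` of the twisted group ring. -/
noncomputable def TwistedGroupRing.basisUnit {k G : Type*} (R : Type*) [CommRing k] [Ring R]
    [Algebra k R] [Group G] (α : TwoCocycle G kˣ) (g : G) : (TwistedGroupRing R α)ˣ where
  val := single g 1
  -- The scalar undoes `α g g⁻¹`, from the product of the two basis elements, and `α 1 1`, since the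
  -- identity is `(α 1 1)⁻¹ \bar 1`.
  inv := single g⁻¹ (algebraMap k R ((α 1 1)⁻¹ * (α g g⁻¹)⁻¹ : kˣ))
  val_inv := by
    rw [single_mul_single, mul_inv_cancel, one_mul, one_def, Algebra.smul_def, ← map_mul,
      ← Units.val_mul, mul_left_comm, mul_inv_cancel, mul_one]
  inv_val := by
    have h : α g⁻¹ g = α g g⁻¹ := by
      have h := α.cocycle g g⁻¹ g
      rw [mul_inv_cancel, inv_mul_cancel, α.one_left, α.one_right g] at h
      exact (mul_right_cancel h).symm
    rw [single_mul_single, inv_mul_cancel, mul_one, one_def, h, Algebra.smul_def, ← map_mul,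
      ← Units.val_mul, mul_left_comm, mul_inv_cancel, mul_one]

namespace TwistedGroupRing

variable {k R G : Type*} [CommRing k] [Ring R] [Algebra k R] [Group G] {α : TwoCocycle G kˣ}

theorem val_basisUnit (g : G) : (basisUnit R α g).val = single g 1 := rfl

theorem single_eq_incl_mul (g : G) (r : R) :
    (single g r : TwistedGroupRing R α) = incl r * (basisUnit R α g).val := by
  rw [val_basisUnit, incl_mul_single, mul_one]

theorem commute_incl_basisUnit (r : R) (g : G) :
    Commute (incl r) (basisUnit R α g).val := by
  rw [Commute, SemiconjBy, val_basisUnit, incl_mul_single, single_mul_incl, mul_one, one_mul]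

/-- The scalars of `k`, as a subring of the twisted group ring. -/
noncomputable def scalar : k →+* TwistedGroupRing R α := incl.comp (algebraMap k R)

theorem commute_scalar (c : k) (x : TwistedGroupRing R α) : Commute (scalar c) x := by
  induction x using induction_on with
  | zero => exact Commute.zero_right _
  | add x y hx hy => exact hx.add_right hy
  | single g r =>
    rw [single_eq_incl_mul]
    refine Commute.mul_right ?_ (commute_incl_basisUnit _ g)
    exact Commute.map (Algebra.commutes c r) incl

theorem basisUnit_mul_basisUnit (g h : G) :
    (basisUnit R α g * (basisUnit R α h).val : TwistedGroupRing R α) =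
      scalar (α g h : k) * (basisUnit R α (g * h)).val := by
  rw [val_basisUnit, val_basisUnit, val_basisUnit, single_mul_single, scalar, RingHom.comp_apply,
    incl_mul_single, mul_one, mul_one, Algebra.smul_def, mul_one]

theorem commute_basisUnit_of_mem_center {z : G} (hz : z ∈ α.center) (x : TwistedGroupRing R α) :
    Commute (basisUnit R α z : TwistedGroupRing R α) x := by
  induction x using induction_on with
  | zero => exact Commute.zero_right _
  | add x y hx hy => exact hx.add_right hy
  | single g r =>
    rw [Commute, SemiconjBy, val_basisUnit, single_mul_single, single_mul_single, hz.2 g,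
      Subgroup.mem_center_iff.1 hz.1 g, one_mul, mul_one]

/-- The logarithmic derivative `d(\bar g) \bar g⁻¹` of a basis element. -/
noncomputable def logDeriv (d : TwistedGroupRing R α → TwistedGroupRing R α) (g : G) :
    TwistedGroupRing R α :=
  d (basisUnit R α g).val * (basisUnit R α g)⁻¹.val

variable {d : TwistedGroupRing R α → TwistedGroupRing R α}

theorem logDeriv_mul_basisUnit (g : G) :
    logDeriv d g * (basisUnit R α g).val = d (basisUnit R α g).val :=
  Units.inv_mul_cancel_right _ _

theorem _root_.IsRelDerivation.map_incl_mul {R S : Type*} [Ring R] [Ring S] {i : R →+* S}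
    {d : S → S} (hd : IsRelDerivation i d) (r : R) (x : S) : d (i r * x) = i r * d x := by
  rw [hd.leibniz, hd.map_incl, zero_mul, zero_add]

/-- Apply `d` to `r ḡ = ḡ r`: since `d` kills `R`, `d(ḡ)` commutes with `r`, as does `ḡ⁻¹`. -/
theorem commute_incl_logDeriv (hd : IsRelDerivation (incl : R →+* TwistedGroupRing R α) d)
    (r : R) (g : G) : Commute (incl r) (logDeriv d g) := by
  refine Commute.mul_right ?_ (commute_incl_basisUnit r g).units_inv_right
  have h := congrArg d (commute_incl_basisUnit (α := α) r g).eq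
  rwa [hd.map_incl_mul, hd.leibniz, hd.map_incl, mul_zero, add_zero] at h

/-- The logarithmic derivative is a crossed homomorphism. -/
theorem logDeriv_mul (hd : IsRelDerivation (incl : R →+* TwistedGroupRing R α) d) (g h : G) :
    logDeriv d (g * h) =
      logDeriv d g + (basisUnit R α g).val * logDeriv d h * (basisUnit R α g)⁻¹.val := by
  have hc : IsUnit (scalar (α g h : k) : TwistedGroupRing R α) := (α g h).isUnit.map scalar
  -- Multiplying by `α g h` and by the basis unit of `g * h` turns the claim into the Leibniz rule
  -- for `ḡ h̄`.
  refine (basisUnit R α (g * h)).isUnit.mul_right_cancel (hc.mul_left_cancel ?_)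
  rw [logDeriv_mul_basisUnit, (commute_scalar _ _).left_comm, ← basisUnit_mul_basisUnit, add_mul,
    ← mul_assoc, logDeriv_mul_basisUnit, mul_assoc _ (basisUnit R α g)⁻¹.val,
    Units.inv_mul_cancel_left,
    mul_assoc, logDeriv_mul_basisUnit, ← hd.leibniz, basisUnit_mul_basisUnit, scalar,
    RingHom.comp_apply, hd.map_incl_mul]

theorem logDeriv_mul_of_mem_center (hd : IsRelDerivation (incl : R →+* TwistedGroupRing R α) d)
    {z : G} (hz : z ∈ α.center) (h : G) : logDeriv d (z * h) = logDeriv d z + logDeriv d h := by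
  rw [logDeriv_mul hd, (commute_basisUnit_of_mem_center hz _).eq, Units.mul_inv_cancel_right]

theorem logDeriv_one (hd : IsRelDerivation (incl : R →+* TwistedGroupRing R α) d) :
    logDeriv d 1 = 0 := by
  simpa using logDeriv_mul_of_mem_center hd (one_mem α.center) 1

theorem logDeriv_pow_of_mem_center (hd : IsRelDerivation (incl : R →+* TwistedGroupRing R α) d)
    {z : G} (hz : z ∈ α.center) (n : ℕ) : logDeriv d (z ^ n) = n * logDeriv d z := by
  induction n with
  | zero => rw [pow_zero, logDeriv_one hd, Nat.cast_zero, zero_mul]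
  | succ n ih =>
    rw [pow_succ', logDeriv_mul_of_mem_center hd hz, ih, Nat.cast_succ, add_mul, one_mul, add_comm]

theorem logDeriv_eq_zero_of_mem_center
    (hd : IsRelDerivation (incl : R →+* TwistedGroupRing R α) d)
    {z : G} (hz : z ∈ α.center) (hn : IsUnit (orderOf z : k)) : logDeriv d z = 0 := by
  have h := logDeriv_pow_of_mem_center hd hz (orderOf z)
  have hu : IsUnit ((orderOf z : ℕ) : TwistedGroupRing R α) := by
    simpa using hn.map (scalar : k →+* TwistedGroupRing R α)
  rw [pow_orderOf_eq_one, logDeriv_one hd] at h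
  exact hu.mul_right_eq_zero.1 h.symm

/-- An `R`-derivation is inner if the orders of the elements of the `α`-center and the index of the
`α`-center are invertible. -/
theorem isInnerDerivation_of_isUnit (hα : α.center.FiniteIndex)
    (hz : ∀ z ∈ α.center, IsUnit (orderOf z : k)) (hi : IsUnit (α.center.index : k))
    (hd : IsRelDerivation (incl : R →+* TwistedGroupRing R α) d) : IsInnerDerivation d := by
  have : Fintype (G ⧸ α.center) := Subgroup.fintypeQuotientOfFiniteIndex
  -- `δ` descends to left cosets: `δ(az) = δ(a) + ā δ(z) ā⁻¹ = δ(a)` for `z` in the `α`-center.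
  let E : G ⧸ α.center → TwistedGroupRing R α := Quotient.lift (logDeriv d) fun a b hab => by
    have hab' : a⁻¹ * b ∈ α.center := QuotientGroup.leftRel_apply.1 hab
    rw [← mul_inv_cancel_left a b, logDeriv_mul hd,
      logDeriv_eq_zero_of_mem_center hd hab' (hz _ hab'), mul_zero, zero_mul, add_zero]
  have hE : ∀ g : G, ∀ q, E (g • q) =
      logDeriv d g + (basisUnit R α g).val * E q * (basisUnit R α g)⁻¹.val := fun g q =>
    Quotient.inductionOn q fun h => logDeriv_mul hd g h
  have hcomm : ∀ (r : R) q, Commute (incl r) (E q) := fun r q =>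
    Quotient.inductionOn q fun h => commute_incl_logDeriv hd r h
  obtain ⟨u, hu⟩ := hi
  have hsum : ∀ g : G, d (basisUnit R α g).val * (scalar (α.center.index : k)) =
      (∑ q, E q) * (basisUnit R α g).val - (basisUnit R α g).val * ∑ q, E q := by
    intro g
    -- Translation by `g` permutes the cosets, so with `S = ∑ q, E q` and `n` the index, `S = n δ(g)
    -- + ḡ S ḡ⁻¹`.
    have h := Equiv.sum_comp (MulAction.toPerm g : Equiv.Perm (G ⧸ α.center)) E
    simp only [MulAction.toPerm_apply, hE, Finset.sum_add_distrib, ← Finset.sum_mul,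
      ← Finset.mul_sum, Finset.sum_const, Finset.card_univ] at h
    -- Only the first `S` is expanded; its conjugated part then cancels against `ḡ S`.
    nth_rw 1 [← h]
    rw [add_mul, Units.inv_mul_cancel_right, add_sub_cancel_right, smul_mul_assoc,
      logDeriv_mul_basisUnit, map_natCast, Subgroup.index_eq_card, Nat.card_eq_fintype_card,
      nsmul_eq_mul, (Nat.cast_commute _ _).eq]
  -- The average of `δ` over the cosets.
  refine ⟨(∑ q, E q) * scalar (↑u⁻¹ : k), fun x => ?_⟩
  induction x using induction_on with
  | zero =>
    have h := hd.map_add 0 0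
    rw [add_zero] at h
    rw [mul_zero, zero_mul, sub_zero, left_eq_add.1 h]
  | add x y hx hy => rw [hd.map_add, hx, hy]; noncomm_ring
  | single g r =>
    have hr : Commute (incl r) ((∑ q, E q) * scalar (↑u⁻¹ : k)) :=
      (Commute.sum_right _ _ _ fun q _ => hcomm r q).mul_right (commute_scalar _ _).symm
    have hg : d (basisUnit R α g).val = (∑ q, E q) * scalar (↑u⁻¹ : k) * (basisUnit R α g).val -
        (basisUnit R α g).val * ((∑ q, E q) * scalar (↑u⁻¹ : k)) := by
      have h := congrArg (· * (scalar (↑u⁻¹ : k) : TwistedGroupRing R α)) (hsum g)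
      simp only [mul_assoc, sub_mul] at h ⊢
      rwa [← map_mul, ← hu, Units.mul_inv, map_one, mul_one,
        ← (commute_scalar (↑u⁻¹ : k) (basisUnit R α g).val).eq] at h
    rw [single_eq_incl_mul, hd.map_incl_mul, hg, mul_sub, hr.symm.left_comm, mul_assoc (incl r)]

end TwistedGroupRing

/-- If a prime divides the index of a normal subgroup of finite index, then it divides the order of
some element. -/
theorem Subgroup.exists_dvd_orderOf_of_dvd_index {G : Type*} [Group G]
    (N : Subgroup G) [N.Normal] [N.FiniteIndex] {p : ℕ} (hp : p.Prime) (h : p ∣ N.index) :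
    ∃ g : G, p ∣ orderOf g := by
  have := Fact.mk hp
  -- Cauchy's theorem in `G ⧸ N`; the order of a lift is a multiple of the order of its image.
  obtain ⟨q, hq⟩ := exists_prime_orderOf_dvd_card' (G := G ⧸ N) p (N.index_eq_card ▸ h)
  obtain ⟨g, rfl⟩ := QuotientGroup.mk_surjective q
  exact ⟨g, hq ▸ orderOf_map_dvd (QuotientGroup.mk' N) g⟩

theorem TwoCocycle.center_normal {G A : Type*} [Group G] [CommGroup A] (α : TwoCocycle G A) :
    α.center.Normal where
  conj_mem a ha g := by rwa [Subgroup.mem_center_iff.1 ha.1 g, mul_inv_cancel_right]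

theorem mainTheorem1 {k R G : Type*} [Field k] [Ring R] [Algebra k R] [Group G]
    (hR : IsSemiprimeRing R) (hG : IsMulTorsion G)
    (α : TwoCocycle G kˣ) (hα : α.center.FiniteIndex)
    (hchar : CharP R 0 ∨ ∀ p : ℕ, p.Prime → CharP R p → ∀ g : G, ¬ p ∣ orderOf g)
    (d : TwistedGroupRing R α → TwistedGroupRing R α)
    (hd : IsRelDerivation (TwistedGroupRing.incl : R →+* TwistedGroupRing R α) d) :
    IsInnerDerivation d := by
  -- When `R ≠ 0`, `k` embeds in `R`, so both have the same characteristic.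
  rcases subsingleton_or_nontrivial R with hs | hs
  · have : Subsingleton (TwistedGroupRing R α) := inferInstanceAs (Subsingleton (G →₀ R))
    exact ⟨0, fun _ => Subsingleton.elim _ _⟩
  obtain ⟨p, hpk⟩ := CharP.exists k
  have hpR : CharP R p := charP_of_injective_algebraMap (algebraMap k R).injective p
  have hdvd : ∀ n : ℕ, n ≠ 0 → (p.Prime → ¬ p ∣ n) → IsUnit (n : k) := by
    intro n hn h
    rw [isUnit_iff_ne_zero, Ne, CharP.cast_eq_zero_iff k p]
    rcases CharP.char_is_prime_or_zero k p with hp | rfl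
    · exact h hp
    · rwa [zero_dvd_iff]
  have hord : p.Prime → ∀ g : G, ¬ p ∣ orderOf g := fun hp => by
    rcases hchar with h0 | h
    · exact absurd (CharP.eq R hpR h0) hp.ne_zero
    · exact h p hp hpR
  have := α.center_normal
  refine TwistedGroupRing.isInnerDerivation_of_isUnit hα
    (fun z _ => hdvd _ (orderOf_pos_iff.2 (hG z)).ne' fun hp => hord hp z)
    (hdvd _ hα.index_ne_zero fun hp h => ?_) hd
  obtain ⟨g, hg⟩ := Subgroup.exists_dvd_orderOf_of_dvd_index _ hp h
  exact hord hp g hg
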